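/- Let $p$ be a prime, let $\mathcal{O}$ be the valuation ring of a finite extension of $\mathbb{Q}_p$ with uniformizer $\varpi$, and let $|\cdot|_\varpi$ be the absolute value on $\mathcal{O}$ with $|\varpi|_\varpi=[\mathcal{O}:\varpi\mathcal{O}]^{-1}$. Let $\Gamma$ be a topological group isomorphic to $\mathbb{Z}_p$ with topological generator $\gamma$, and identify the Iwasawa algebra $\Lambda_{\mathcal{O}}=\mathbb{Z}_p[[\Gamma]]\otimes_{\mathbb{Z}_p}\mathcal{O}$ with $\mathcal{O}[[T]]$ through $T=\gamma-1$. Let $\mathcal{D}$ be a discrete $p$-primary $\Lambda_{\mathcal{O}}$-module, and suppose that its Pontryagin dual $\mathcal{D}^\vee=\operatorname{Hom}_{\mathbb{Z}_p}(\mathcal{D},\mathbb{Q}_p/\mathbb{Z}_p)$, with the action $(a\varphi)(d)=\varphi(ad)$, is a finitely generated torsion $\Lambda_{\mathcal{O}}$-module (that is, $\mathcal{D}$ is cofinitely generated and cotorsion). Let $f_{\mathcal{D}}(T)=\prod_{i}\varpi^{\mu_i}\prod_{j} g_j(T)^{\lambda_j}$ be the characteristic series of $\mathcal{D}^\vee$,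 where $\mu_i,\lambda_j\ge 0$ are integers and the $g_j$ are irreducible distinguished polynomials for which there is a homomorphism of $\Lambda_{\mathcal{O}}$-modules $$\mathcal{D}^\vee\longrightarrow \Big(\bigoplus_{i=1}^s \mathcal{O}[[T]]/(\varpi^{\mu_i})\Big)\oplus\Big(\bigoplus_{j=1}^t \mathcal{O}[[T]]/(g_j(T)^{\lambda_j})\Big)$$ with finite kernel and cokernel. The Euler characteristic of $\mathcal{D}$ is said to be well defined if $H^0(\Gamma,\mathcal{D})=\mathcal{D}^\Gamma$ is finite, and then $\chi(\Gamma,\mathcal{D}):=\#H^0(\Gamma,\mathcal{D})/\#H^1(\Gamma,\mathcal{D})$, where $H^1$ is continuous cohomology (one has $H^i(\Gamma,\mathcal{D})=0$ for $i\ge 2$). Then the Euler characteristic of $\mathcal{D}$ is well defined if and only if $f_{\mathcal{D}}(0)\neq 0$. Moreover, if $f_{\mathcal{D}}(0)\ne 0$, then $\chi(\Gamma,\mathcal{D})=|f_{\mathcal{D}}(0)|_\varpi^{-1}$. -/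

import Mathlib

namespace Iwasawa

open PowerSeries

/-- The Iwasawa algebra `Λ_𝒪`, identified with `𝒪⟦T⟧` through `T = γ - 1`, where `γ` is a chosen
topological generator of `Γ`. -/
abbrev IwasawaAlgebra (O : Type*) [CommRing O] : Type _ := PowerSeries O

/-- The `ℤ_p`-module `ℚ_p / ℤ_p`. -/
abbrev QpModZp (p : ℕ) [Fact p.Prime] : Type :=
  ℚ_[p] ⧸ LinearMap.range (Algebra.linearMap ℤ_[p] ℚ_[p])

/-- The Pontryagin dual `D^∨ = Hom_{ℤ_p}(D, ℚ_p / ℤ_p)`. -/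
def Dual (p : ℕ) [Fact p.Prime] (D : Type*) [AddCommGroup D] [Module ℤ_[p] D] : Type _ :=
  D →ₗ[ℤ_[p]] QpModZp p

section Dual

variable (p : ℕ) [Fact p.Prime] (D : Type*) [AddCommGroup D] [Module ℤ_[p] D]

noncomputable instance : AddCommGroup (Dual p D) :=
  inferInstanceAs (AddCommGroup (D →ₗ[ℤ_[p]] QpModZp p))

instance : FunLike (Dual p D) D (QpModZp p) :=
  inferInstanceAs (FunLike (D →ₗ[ℤ_[p]] QpModZp p) D (QpModZp p))

/-- The `R`-module structure on the dual of an `R`-module: `(a • φ) d = φ (a • d)`. -/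
noncomputable instance (R : Type*) [CommRing R] [Algebra ℤ_[p] R] [Module R D]
    [IsScalarTower ℤ_[p] R D] : Module R (Dual p D) where
  smul a φ := LinearMap.comp (show D →ₗ[ℤ_[p]] QpModZp p from φ) (Algebra.lsmul ℤ_[p] ℤ_[p] D a)
  one_smul φ := LinearMap.ext fun d => congrArg φ (one_smul R d)
  mul_smul a b φ := LinearMap.ext fun d =>
    congrArg φ (show (a * b) • d = b • a • d by rw [mul_comm, mul_smul])
  smul_zero _ := LinearMap.ext fun _ => rfl
  smul_add _ _ _ := LinearMap.ext fun _ => rfl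
  add_smul a b φ := LinearMap.ext fun d =>
    (congrArg φ (add_smul a b d)).trans
      (map_add (show D →ₗ[ℤ_[p]] QpModZp p from φ) (a • d) (b • d))
  zero_smul φ := LinearMap.ext fun d =>
    (congrArg φ (zero_smul R d)).trans (map_zero (show D →ₗ[ℤ_[p]] QpModZp p from φ))

theorem Dual.smul_apply (R : Type*) [CommRing R] [Algebra ℤ_[p] R] [Module R D]
    [IsScalarTower ℤ_[p] R D] (a : R) (φ : Dual p D) (d : D) : (a • φ) d = φ (a • d) := rfl

end Dual

/-- `f` is the characteristic element of the `𝒪⟦T⟧`-module `M` given by some homomorphism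
`M → (⨁_i 𝒪⟦T⟧ / (ϖ ^ μ_i)) ⊕ (⨁_j 𝒪⟦T⟧ / (g_j ^ l_j))` with finite kernel and cokernel,
in which the `g_j` are irreducible distinguished polynomials:
`f = ∏_i ϖ ^ μ_i * ∏_j g_j ^ l_j`. -/
def IsCharacteristicElement {O : Type*} [CommRing O] (ϖ : O)
    (M : Type*) [AddCommGroup M] [Module (IwasawaAlgebra O) M] (f : IwasawaAlgebra O) : Prop :=
  ∃ (s t : ℕ) (μ : Fin s → ℕ) (g : Fin t → Polynomial O) (l : Fin t → ℕ)
    (φ : M →ₗ[IwasawaAlgebra O]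
      ((∀ i : Fin s, IwasawaAlgebra O ⧸ Ideal.span {(C ϖ : IwasawaAlgebra O) ^ μ i}) ×
       (∀ j : Fin t, IwasawaAlgebra O ⧸ Ideal.span {(g j : IwasawaAlgebra O) ^ l j}))),
    (∀ j, (g j).IsDistinguishedAt (Ideal.span {ϖ}) ∧ Irreducible (g j)) ∧
    Finite (LinearMap.ker φ) ∧ Finite (_ ⧸ LinearMap.range φ) ∧
    f = (∏ i, (C ϖ : IwasawaAlgebra O) ^ μ i) * ∏ j, (g j : IwasawaAlgebra O) ^ l j

section Cohomology

variable (Γ D : Type*) [Group Γ] [TopologicalSpace Γ] [AddCommGroup D] [TopologicalSpace D]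
  [DiscreteTopology D] [DistribMulAction Γ D]

/-- `H⁰(Γ, D) = D^Γ`. -/
abbrev H0 : Type _ := FixedPoints.addSubgroup Γ D

/-- Continuous `1`-cocycles (crossed homomorphisms) `Γ → D`. -/
def Z1 : AddSubgroup (Γ → D) where
  carrier := {c | Continuous c ∧ ∀ g h, c (g * h) = c g + g • c h}
  zero_mem' := ⟨continuous_const, fun g h => by simp⟩
  add_mem' := by
    rintro a b ⟨ha, ha'⟩ ⟨hb, hb'⟩
    refine ⟨ha.add hb, fun g h => ?_⟩
    simp only [Pi.add_apply, ha', hb', smul_add]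
    abel
  neg_mem' := by
    rintro a ⟨ha, ha'⟩
    refine ⟨ha.neg, fun g h => ?_⟩
    simp only [Pi.neg_apply, ha', smul_neg]
    abel

/-- `1`-coboundaries `g ↦ g • d - d`. -/
def B1 : AddSubgroup (Γ → D) where
  carrier := {c | ∃ d : D, ∀ g, c g = g • d - d}
  zero_mem' := ⟨0, fun g => by simp⟩
  add_mem' := by
    rintro a b ⟨d, hd⟩ ⟨e, he⟩
    refine ⟨d + e, fun g => ?_⟩
    simp only [Pi.add_apply, hd, he, smul_add]
    abel
  neg_mem' := by
    rintro a ⟨d, hd⟩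
    refine ⟨-d, fun g => ?_⟩
    simp only [Pi.neg_apply, hd, smul_neg]
    abel

/-- `H¹(Γ, D)`, the continuous cohomology of `Γ` in the discrete module `D` in degree `1`. -/
abbrev H1 : Type _ := Z1 Γ D ⧸ (B1 Γ D).addSubgroupOf (Z1 Γ D)

/-- The Euler characteristic of `D` is well defined if `H⁰(Γ, D)` is finite. -/
def EulerCharWellDefined : Prop := Finite (H0 Γ D)

/-- The Euler characteristic `χ(Γ, D) = #H⁰(Γ, D) / #H¹(Γ, D)`. -/
noncomputable def eulerChar : ℝ := (Nat.card (H0 Γ D) : ℝ) / (Nat.card (H1 Γ D) : ℝ)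

end Cohomology

open Classical in
/-- The absolute value `|·|_ϖ` on a discrete valuation ring with uniformizer `ϖ`, normalized by
`|ϖ|_ϖ = [𝒪 : ϖ𝒪]⁻¹`. -/
noncomputable def absVal {O : Type*} [CommRing O] (ϖ x : O) : ℝ :=
  if x = 0 then 0 else ((Nat.card (O ⧸ Ideal.span {ϖ}) : ℝ)⁻¹) ^ multiplicity ϖ x

end Iwasawa

/-! ### Herbrand quotients of endomorphisms of abelian groups -/

namespace AddMonoidHom

variable {X E : Type*} [AddCommGroup X] [AddCommGroup E] {T : X →+ X} {S : E →+ E} {φ : X →+ E}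

/-! Write `M` for the dual of `D`. Since `Γ` is topologically generated by `γ = 1 + T`, `H⁰` is the
kernel of `T` on `D` and `H¹` is its cokernel (`card_H1`). Pontryagin duality is exact and preserves
the cardinality of `p`-primary modules, so these have the sizes of `M/TM` and of the kernel of `T`
on `M`. The Euler characteristic is therefore the Herbrand quotient of `T` on `M`.

That quotient does not change along a map with finite kernel and cokernel to a module on which `T`
is injective (`index_range_eq_mul_card_ker`). On `𝒪⟦T⟧/(h)` the cokernel of `T` is `𝒪/(h(0))`, and
`T` is injective if `h(0) ≠ 0`. Multiplying over the summands gives `#(𝒪/(f(0)))`, which is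
`|f(0)|⁻¹`.

Indices and `Nat.card` are `0` when infinite. Equalities of counts thus carry finiteness as well: if
`f(0) = 0`, then `𝒪/(f(0))` is infinite, `M/TM` has count `0`, and `H⁰` is infinite. -/

/-- Both sides compute the index in `E` of the one subgroup `φ(T X) = S(φ X)`. -/
theorem index_range_sup_ker_mul (h : ∀ x, φ (T x) = S (φ x)) :
    (T.range ⊔ φ.ker).index * φ.range.index = (φ.range ⊔ S.ker).index * S.range.index := by
  rw [← AddSubgroup.index_map, ← AddSubgroup.index_map]
  congr 1
  ext y
  constructor
  · rintro ⟨_, ⟨x, rfl⟩, rfl⟩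
    exact ⟨φ x, ⟨x, rfl⟩, (h x).symm⟩
  · rintro ⟨_, ⟨x, rfl⟩, rfl⟩
    exact ⟨T x, ⟨x, rfl⟩, h x⟩

/-- An endomorphism of a group has infinite cokernel as soon as it is compatible, along a
homomorphism with finite cokernel, with an endomorphism that does. -/
theorem index_range_eq_zero_of_semiconj (h : ∀ x, φ (T x) = S (φ x)) (hφ : φ.range.index ≠ 0)
    (hS : S.range.index = 0) : T.range.index = 0 := by
  have h1 := index_range_sup_ker_mul h
  rw [hS, mul_zero] at h1
  have h2 := (mul_eq_zero.mp h1).resolve_right hφ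
  exact Nat.eq_zero_of_zero_dvd (h2 ▸ AddSubgroup.index_dvd_of_le (le_sup_left (a := T.range)))

theorem ker_le_ker_of_semiconj (h : ∀ x, φ (T x) = S (φ x)) (hS : Function.Injective S) :
    T.ker ≤ φ.ker := fun x (hx : T x = 0) => hS (by rw [← h, hx, map_zero, map_zero])

/-- Invariance of the Herbrand quotient of an endomorphism under homomorphisms with finite kernel
and cokernel, when the target endomorphism is injective. -/
theorem index_range_eq_mul_card_ker (h : ∀ x, φ (T x) = S (φ x)) (hS : Function.Injective S)
    [Finite φ.ker] (hφ : φ.range.index ≠ 0) :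
    T.range.index = S.range.index * Nat.card T.ker := by
  have hker : T.ker ≤ φ.ker := ker_le_ker_of_semiconj h hS
  have h1 : (T.range ⊔ φ.ker).index = S.range.index := by
    have := index_range_sup_ker_mul h
    rw [(AddMonoidHom.ker_eq_bot_iff S).mpr hS, sup_bot_eq, mul_comm] at this
    exact Nat.eq_of_mul_eq_mul_left (Nat.pos_of_ne_zero hφ) this
  have hmap : T.range ⊓ φ.ker = φ.ker.map T := by
    ext y
    constructor
    · rintro ⟨⟨x, rfl⟩, hy⟩
      exact ⟨x, hS (by rw [← h, map_zero]; exact hy), rfl⟩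
    · rintro ⟨x, hx, rfl⟩
      exact ⟨⟨x, rfl⟩, show φ (T x) = 0 by rw [h, show φ x = 0 from hx, map_zero]⟩
  -- `T` maps the finite group `φ.ker` onto `T.range ⊓ φ.ker` with kernel `T.ker`, so the index of
  -- the image is the order of `T.ker`.
  have h2 : T.range.relIndex φ.ker = Nat.card T.ker := by
    have hle : φ.ker.map T ≤ φ.ker := hmap ▸ inf_le_right
    have hfin : Finite (φ.ker.map T) := Finite.Set.subset (φ.ker : Set X) hle
    have e1 := AddSubgroup.relIndex_mul_relIndex ⊥ _ _ bot_le hle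
    have e2 := AddSubgroup.relIndex_mul_relIndex ⊥ _ _ bot_le hker
    rw [AddSubgroup.relIndex_bot_left, AddSubgroup.relIndex_bot_left] at e1 e2
    rw [AddSubgroup.relIndex_ker, ← e1, mul_comm (Nat.card T.ker)] at e2
    rw [← AddSubgroup.inf_relIndex_right, hmap]
    exact (Nat.eq_of_mul_eq_mul_left Nat.card_pos e2).symm
  rw [← AddSubgroup.relIndex_mul_index (le_sup_left : T.range ≤ T.range ⊔ φ.ker), h1,
    AddSubgroup.relIndex_sup_left, h2, mul_comm]

end AddMonoidHom

theorem AddSubgroup.index_univ_pi {ι : Type*} [Fintype ι] {G : ι → Type*}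
    [∀ i, AddCommGroup (G i)] (H : ∀ i, AddSubgroup (G i)) :
    (AddSubgroup.pi Set.univ H).index = ∏ i, (H i).index := by
  simp_rw [AddSubgroup.index, ← Nat.card_pi]
  refine Nat.card_congr
    ((Quotient.congrRight (fun x y ↦ ?_)).trans (Setoid.piQuotientEquiv _).symm)
  rw [QuotientAddGroup.leftRel_pi]

/-! ### Multiplication by `T` on elementary modules -/

namespace Iwasawa

open PowerSeries

/-- Multiplication by `a` on a module, as an additive endomorphism. -/
abbrev smulHom {R : Type*} [CommRing R] (a : R) (M : Type*) [AddCommGroup M] [Module R M] :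
    M →+ M := DistribSMul.toAddMonoidHom M a

section Smul

variable {R : Type*} [CommRing R] (a : R)

theorem index_range_smulHom_prod (M N : Type*) [AddCommGroup M] [Module R M] [AddCommGroup N]
    [Module R N] : (smulHom a (M × N)).range.index =
      (smulHom a M).range.index * (smulHom a N).range.index := by
  rw [← AddSubgroup.index_prod]
  congr 1
  ext ⟨x, y⟩
  constructor
  · rintro ⟨⟨u, v⟩, h⟩
    exact ⟨⟨u, congrArg Prod.fst h⟩, ⟨v, congrArg Prod.snd h⟩⟩
  · rintro ⟨⟨u, hu⟩, ⟨v, hv⟩⟩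
    exact ⟨(u, v), Prod.ext hu hv⟩

theorem index_range_smulHom_pi {ι : Type*} [Fintype ι] (M : ι → Type*)
    [∀ i, AddCommGroup (M i)] [∀ i, Module R (M i)] : (smulHom a (∀ i, M i)).range.index =
      ∏ i, (smulHom a (M i)).range.index := by
  rw [← AddSubgroup.index_univ_pi fun i => (smulHom a (M i)).range]
  congr 1
  ext x
  simp only [AddMonoidHom.mem_range, AddSubgroup.mem_pi, Set.mem_univ, true_imp_iff]
  constructor
  · rintro ⟨u, rfl⟩ i
    exact ⟨u i, rfl⟩
  · intro h
    choose u hu using h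
    exact ⟨u, funext hu⟩

/-- Use the chain `(ab) ⊆ (a) ⊆ R`, where multiplication by `a ≠ 0` identifies `R/(b)` with
`(a)/(ab)`. For `a = 0` both sides vanish because `R` is infinite. -/
theorem card_quotient_span_mul [IsDomain R] [Infinite R] (a b : R) :
    Nat.card (R ⧸ Ideal.span {a * b}) =
      Nat.card (R ⧸ Ideal.span {a}) * Nat.card (R ⧸ Ideal.span {b}) := by
  have hinf : Nat.card (R ⧸ Ideal.span {(0 : R)}) = 0 := by
    rw [Ideal.span_singleton_zero]
    exact (Nat.card_congr (RingEquiv.quotientBot R).toEquiv).trans Nat.card_eq_zero_of_infinite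
  rcases eq_or_ne a 0 with rfl | ha
  · rw [zero_mul, hinf, zero_mul]
  have hmul := AddSubgroup.index_map_of_injective (Ideal.span {b}).toAddSubgroup
    (f := AddMonoidHom.mulLeft a) (mul_right_injective₀ ha)
  have h1 : (Ideal.span {b}).toAddSubgroup.map (AddMonoidHom.mulLeft a) =
      (Ideal.span {a * b}).toAddSubgroup := by
    ext x
    simp only [AddSubgroup.mem_map, Submodule.mem_toAddSubgroup, Ideal.mem_span_singleton]
    constructor
    · rintro ⟨_, ⟨c, rfl⟩, rfl⟩
      exact ⟨c, (mul_assoc _ _ _).symm⟩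
    · rintro ⟨c, rfl⟩
      exact ⟨b * c, ⟨c, rfl⟩, (mul_assoc _ _ _).symm⟩
  have h2 : (AddMonoidHom.mulLeft a).range = (Ideal.span {a}).toAddSubgroup := by
    ext x
    simp only [AddMonoidHom.mem_range, Submodule.mem_toAddSubgroup, Ideal.mem_span_singleton]
    exact exists_congr fun c => eq_comm
  rw [h1, h2] at hmul
  exact hmul.trans (mul_comm _ _)

theorem card_quotient_span_prod [IsDomain R] [Infinite R] {ι : Type*} (s : Finset ι) (a : ι → R) :
    Nat.card (R ⧸ Ideal.span {∏ i ∈ s, a i}) = ∏ i ∈ s, Nat.card (R ⧸ Ideal.span {a i}) := by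
  classical
  induction s using Finset.induction_on with
  | empty => simp
  | insert i s hi ih => rw [Finset.prod_insert hi, Finset.prod_insert hi,
      card_quotient_span_mul, ih]

theorem card_quotient_span_pow [IsDomain R] [Infinite R] (a : R) (n : ℕ) :
    Nat.card (R ⧸ Ideal.span {a ^ n}) = Nat.card (R ⧸ Ideal.span {a}) ^ n := by
  simpa using card_quotient_span_prod (Finset.range n) (fun _ => a)

end Smul

section PowerSeries

variable {O : Type*} [CommRing O] (h : IwasawaAlgebra O)

/-- Killing `X` and then `h` leaves `O` modulo the constant term of `h`: both subgroups pull back to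
the ideal `(X, h)` of `O⟦X⟧`. -/
theorem index_range_smulHom_quotient_span :
    (smulHom (X : IwasawaAlgebra O) (IwasawaAlgebra O ⧸ Ideal.span {h})).range.index =
      Nat.card (O ⧸ Ideal.span {constantCoeff h}) := by
  set I := Ideal.span {h}
  rw [← AddSubgroup.index_comap_of_surjective (f := (Submodule.mkQ I).toAddMonoidHom) _
    (Submodule.mkQ_surjective I)]
  change _ = (Ideal.span {constantCoeff h}).toAddSubgroup.index
  rw [← AddSubgroup.index_comap_of_surjective
    (f := (constantCoeff : IwasawaAlgebra O →+* O).toAddMonoidHom) _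
    (constantCoeff_surj)]
  congr 1
  ext x
  simp only [AddSubgroup.mem_comap, AddMonoidHom.mem_range, Submodule.mem_toAddSubgroup,
    Ideal.mem_span_singleton]
  constructor
  · rintro ⟨y, hy⟩
    obtain ⟨y, rfl⟩ := Submodule.mkQ_surjective I y
    have hy' : (X * y - x : IwasawaAlgebra O) ∈ I := (Submodule.Quotient.eq I).mp hy
    obtain ⟨z, hz⟩ := Ideal.mem_span_singleton.mp hy'
    refine ⟨constantCoeff (-z), ?_⟩
    have := congrArg constantCoeff hz
    simp only [map_sub, map_mul, constantCoeff_X, zero_mul, zero_sub] at this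
    change constantCoeff x = _
    rw [map_neg, mul_neg, ← this, neg_neg]
  · rintro ⟨z, hz⟩
    have hz' : constantCoeff (x - h * C z) = 0 := by
      rw [map_sub, map_mul, constantCoeff_C, sub_eq_zero]
      exact hz
    obtain ⟨y, hy⟩ := X_dvd_iff.mpr hz'
    refine ⟨Submodule.mkQ I y, (Submodule.Quotient.eq I).mpr ?_⟩
    change (X * y - x : IwasawaAlgebra O) ∈ I
    rw [← hy, sub_sub_cancel_left, neg_mem_iff]
    exact Ideal.mul_mem_right _ _ (Ideal.mem_span_singleton_self h)

/-- If `X y = h z`, comparing constant terms forces `X ∣ z`, and cancelling `X` gives `h ∣ y`. -/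
theorem smulHom_quotient_span_injective [IsDomain O] (h0 : constantCoeff h ≠ 0) :
    Function.Injective
      (smulHom (X : IwasawaAlgebra O) (IwasawaAlgebra O ⧸ Ideal.span {h})) := by
  set I := Ideal.span {h}
  rw [injective_iff_map_eq_zero]
  intro y hy
  obtain ⟨y, rfl⟩ := Submodule.mkQ_surjective I y
  have hy' : (X * y : IwasawaAlgebra O) ∈ I := (Submodule.Quotient.mk_eq_zero I).mp hy
  obtain ⟨z, hz⟩ := Ideal.mem_span_singleton.mp hy'
  have hc := congrArg constantCoeff hz
  simp only [map_mul, constantCoeff_X, zero_mul] at hc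
  obtain ⟨w, rfl⟩ := X_dvd_iff.mpr ((mul_eq_zero.mp hc.symm).resolve_left h0)
  refine (Submodule.Quotient.mk_eq_zero I).mpr (Ideal.mem_span_singleton.mpr ⟨w, ?_⟩)
  exact mul_left_cancel₀ X_ne_zero (hz.trans (mul_left_comm _ _ _))

end PowerSeries

/-- The characteristic element computes the Herbrand quotient of `T` on the module. -/
theorem IsCharacteristicElement.index_range {O : Type*} [CommRing O] [IsDomain O] [Infinite O]
    {ϖ : O} {M : Type*} [AddCommGroup M] [Module (IwasawaAlgebra O) M] {f : IwasawaAlgebra O}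
    (hf : IsCharacteristicElement ϖ M f) :
    (constantCoeff f = 0 → (smulHom (X : IwasawaAlgebra O) M).range.index = 0) ∧
    (constantCoeff f ≠ 0 → Finite (smulHom (X : IwasawaAlgebra O) M).ker ∧
      (smulHom (X : IwasawaAlgebra O) M).range.index =
        Nat.card (O ⧸ Ideal.span {constantCoeff f}) *
          Nat.card (smulHom (X : IwasawaAlgebra O) M).ker) := by
  obtain ⟨s, t, μ, g, l, φ, -, hker, hcoker, rfl⟩ := hf
  have hsemi : ∀ x, φ.toAddMonoidHom (smulHom (X : IwasawaAlgebra O) M x) =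
      smulHom (X : IwasawaAlgebra O) _ (φ.toAddMonoidHom x) := fun x => φ.map_smul X x
  have hrange : φ.toAddMonoidHom.range.index ≠ 0 :=
    AddSubgroup.index_ne_zero_iff_finite.mpr hcoker
  have hker' : Finite φ.toAddMonoidHom.ker := hker
  have hindex := (index_range_smulHom_prod (X : IwasawaAlgebra O)
    (∀ i : Fin s, IwasawaAlgebra O ⧸ Ideal.span {(C ϖ : IwasawaAlgebra O) ^ μ i})
    (∀ j : Fin t, IwasawaAlgebra O ⧸ Ideal.span {(g j : IwasawaAlgebra O) ^ l j}))
  simp only [index_range_smulHom_pi, index_range_smulHom_quotient_span] at hindex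
  -- Multiplicativity reassembles the indices of the summands into the order of `O ⧸ (f(0))`.
  rw [← card_quotient_span_prod, ← card_quotient_span_prod, ← card_quotient_span_mul,
    ← map_prod, ← map_prod, ← map_mul] at hindex
  constructor
  · intro h0
    refine AddMonoidHom.index_range_eq_zero_of_semiconj hsemi hrange ?_
    rw [hindex, h0, Ideal.span_singleton_zero]
    exact (Nat.card_congr (RingEquiv.quotientBot O).toEquiv).trans Nat.card_eq_zero_of_infinite
  · intro h0
    rw [map_mul, map_prod, map_prod] at h0
    have h1 := Finset.prod_ne_zero_iff.mp (left_ne_zero_of_mul h0)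
    have h2 := Finset.prod_ne_zero_iff.mp (right_ne_zero_of_mul h0)
    have hinj : Function.Injective (smulHom (X : IwasawaAlgebra O)
        ((∀ i : Fin s, IwasawaAlgebra O ⧸ Ideal.span {(C ϖ : IwasawaAlgebra O) ^ μ i}) ×
         (∀ j : Fin t, IwasawaAlgebra O ⧸ Ideal.span {(g j : IwasawaAlgebra O) ^ l j}))) := by
      rintro ⟨x, y⟩ ⟨x', y'⟩ hxy
      refine Prod.ext (funext fun i => ?_) (funext fun j => ?_)
      · exact smulHom_quotient_span_injective _ (h1 i (Finset.mem_univ _))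
          (congrFun (congrArg Prod.fst hxy) i)
      · exact smulHom_quotient_span_injective _ (h2 j (Finset.mem_univ _))
          (congrFun (congrArg Prod.snd hxy) j)
    refine ⟨Finite.Set.subset (φ.toAddMonoidHom.ker : Set M)
      (AddMonoidHom.ker_le_ker_of_semiconj hsemi hinj), ?_⟩
    rw [← hindex]
    exact AddMonoidHom.index_range_eq_mul_card_ker hsemi hinj hrange

end Iwasawa

/-! ### Pontryagin duality for `p`-primary `ℤ_p`-modules -/

namespace Iwasawa

section Duality

variable (p : ℕ) [Fact p.Prime]

instance : Ring.HasFiniteQuotients ℤ_[p] where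
  finiteQuotient {I} hI := by
    obtain ⟨n, rfl⟩ := PadicInt.ideal_eq_span_pow_p hI
    rw [← PadicInt.ker_toZModPow]
    have : NeZero (p ^ n) := ⟨pow_ne_zero _ (Fact.out : p.Prime).ne_zero⟩
    exact Finite.of_injective _
      (RingHom.kerLift_injective (PadicInt.toZModPow n : ℤ_[p] →+* ZMod (p ^ n)))

theorem QpModZp.exists_smul_eq {m : ℤ_[p]} (hm : m ≠ 0) (q : QpModZp p) : ∃ q', m • q' = q := by
  obtain ⟨x, rfl⟩ := Submodule.mkQ_surjective _ q
  refine ⟨Submodule.mkQ _ ((m : ℚ_[p])⁻¹ * x), ?_⟩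
  rw [← map_smul, Algebra.smul_def]
  congr 1
  exact mul_inv_cancel_left₀ (by simpa using hm) x

/-- A divisible module over a principal ideal domain is injective: a map on `(m)` extends by
dividing its value at `m` by `m`. -/
theorem QpModZp.baer : Module.Baer ℤ_[p] (QpModZp p) := fun I g ↦ by
  rcases IsPrincipalIdealRing.principal I with ⟨m, rfl⟩
  obtain rfl | h0 := eq_or_ne m 0
  · refine ⟨0, fun n hn ↦ ?_⟩
    rw [Submodule.span_zero_singleton] at hn
    subst hn
    exact (map_zero g).symm
  obtain ⟨q, hq⟩ := QpModZp.exists_smul_eq p h0 (g ⟨m, Submodule.subset_span rfl⟩)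
  refine ⟨LinearMap.toSpanSingleton ℤ_[p] _ q, fun n hn ↦ ?_⟩
  rcases Submodule.mem_span_singleton.mp hn with ⟨n, rfl⟩
  rw [map_smul, LinearMap.toSpanSingleton_apply, hq, ← map_smul g, SetLike.mk_smul_mk]

/-- The map `z ↦ z / m` from `ℤ_p` to `ℚ_p / ℤ_p`. -/
noncomputable def divHom (m : ℤ_[p]) : ℤ_[p] →ₗ[ℤ_[p]] QpModZp p :=
  LinearMap.toSpanSingleton ℤ_[p] _ (Submodule.mkQ _ ((m : ℚ_[p])⁻¹))

variable {p}

theorem ker_divHom {m : ℤ_[p]} (hm : m ≠ 0) : LinearMap.ker (divHom p m) = Ideal.span {m} := by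
  have hm' : (m : ℚ_[p]) ≠ 0 := by simpa using hm
  ext z
  rw [LinearMap.mem_ker, Ideal.mem_span_singleton, divHom, LinearMap.toSpanSingleton_apply,
    ← map_smul, Submodule.mkQ_apply, Submodule.Quotient.mk_eq_zero, Algebra.smul_def]
  constructor
  · rintro ⟨y, hy⟩
    refine ⟨y, ?_⟩
    have hy' : (y : ℚ_[p]) = z * (m : ℚ_[p])⁻¹ := hy
    apply Subtype.ext
    rw [PadicInt.coe_mul, hy']
    field_simp
  · rintro ⟨y, rfl⟩
    refine ⟨y, ?_⟩
    change (y : ℚ_[p]) = ((m * y : ℤ_[p]) : ℚ_[p]) * (m : ℚ_[p])⁻¹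
    rw [PadicInt.coe_mul]
    field_simp

theorem mem_range_divHom {m : ℤ_[p]} (hm : m ≠ 0) (q : QpModZp p) :
    q ∈ LinearMap.range (divHom p m) ↔ m • q = 0 := by
  have hm' : (m : ℚ_[p]) ≠ 0 := by simpa using hm
  constructor
  · rintro ⟨z, rfl⟩
    rw [← map_smul, ← LinearMap.mem_ker, ker_divHom hm, smul_eq_mul]
    exact Ideal.mul_mem_right _ _ (Ideal.mem_span_singleton_self m)
  · intro h
    obtain ⟨x, rfl⟩ := Submodule.mkQ_surjective _ q
    rw [← map_smul, Submodule.mkQ_apply, Submodule.Quotient.mk_eq_zero, Algebra.smul_def] at h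
    obtain ⟨y, hy⟩ := h
    have hy' : (y : ℚ_[p]) = m * x := hy
    refine ⟨y, ?_⟩
    rw [divHom, LinearMap.toSpanSingleton_apply, ← map_smul, Algebra.smul_def]
    congr 1
    change (y : ℚ_[p]) * (m : ℚ_[p])⁻¹ = x
    rw [hy']
    field_simp

theorem card_range_divHom {m : ℤ_[p]} (hm : m ≠ 0) :
    Nat.card (LinearMap.range (divHom p m)) = Nat.card (ℤ_[p] ⧸ Ideal.span {m}) := by
  rw [← ker_divHom hm]
  exact (Nat.card_congr (LinearMap.quotKerEquivRange (divHom p m)).toEquiv).symm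

theorem finite_range_divHom {m : ℤ_[p]} (hm : m ≠ 0) : Finite (LinearMap.range (divHom p m)) := by
  have := Ring.HasFiniteQuotients.finiteQuotient (I := Ideal.span {m}) (by simpa using hm)
  rw [← ker_divHom hm] at this
  exact Finite.of_equiv _ (LinearMap.quotKerEquivRange (divHom p m)).toEquiv

/-- A functional is determined by its value at `1`, which can be any `m`-torsion element, and the
`m`-torsion is the range of `divHom p m`. -/
theorem card_hom_quotient_span {m : ℤ_[p]} (hm : m ≠ 0) :
    Nat.card ((ℤ_[p] ⧸ Ideal.span {m}) →ₗ[ℤ_[p]] QpModZp p) =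
      Nat.card (ℤ_[p] ⧸ Ideal.span {m}) := by
  rw [← card_range_divHom hm]
  have hm1 : m • Submodule.mkQ (Ideal.span {m}) 1 = 0 := by
    rw [← map_smul, Submodule.mkQ_apply, Submodule.Quotient.mk_eq_zero, smul_eq_mul, mul_one]
    exact Ideal.mem_span_singleton_self m
  refine Nat.card_eq_of_bijective (fun φ => ⟨φ (Submodule.mkQ _ 1), (mem_range_divHom hm _).mpr
    (by rw [← map_smul, hm1, map_zero])⟩) ⟨fun φ ψ h => ?_, fun ⟨q, hq⟩ => ?_⟩
  · exact Submodule.linearMap_qext _ (LinearMap.ext_ring (congrArg Subtype.val h))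
  · refine ⟨Submodule.liftQ _ (LinearMap.toSpanSingleton ℤ_[p] _ q) ?_, Subtype.ext ?_⟩
    · rw [Submodule.span_le, Set.singleton_subset_iff]
      exact (mem_range_divHom hm q).mp hq
    · change LinearMap.toSpanSingleton ℤ_[p] _ q 1 = q
      exact LinearMap.toSpanSingleton_apply_one ..

universe u

variable {A B : Type u} [AddCommGroup A] [Module ℤ_[p] A] [AddCommGroup B] [Module ℤ_[p] B]

/-- Precomposition with `f` on `ℚ_p / ℤ_p`-duals. -/
noncomputable abbrev dualHom (f : A →ₗ[ℤ_[p]] B) :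
    (B →ₗ[ℤ_[p]] QpModZp p) →+ (A →ₗ[ℤ_[p]] QpModZp p) :=
  (LinearMap.lcomp ℤ_[p] (QpModZp p) f).toAddMonoidHom

theorem dualHom_surjective {f : A →ₗ[ℤ_[p]] B} (hf : Function.Injective f) :
    Function.Surjective (dualHom f) := fun g =>
  (QpModZp.baer p).extension_property f hf g

theorem card_ker_dualHom (f : A →ₗ[ℤ_[p]] B) :
    Nat.card (dualHom f).ker = Nat.card ((B ⧸ LinearMap.range f) →ₗ[ℤ_[p]] QpModZp p) := by
  have hmem (φ : (B ⧸ LinearMap.range f) →ₗ[ℤ_[p]] QpModZp p) :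
      φ ∘ₗ Submodule.mkQ _ ∈ (dualHom f).ker := LinearMap.ext fun a => by
    change φ (Submodule.mkQ _ (f a)) = 0
    rw [Submodule.mkQ_apply, (Submodule.Quotient.mk_eq_zero _).mpr (LinearMap.mem_range_self f a),
      map_zero]
  refine (Nat.card_eq_of_bijective (fun φ => ⟨φ ∘ₗ Submodule.mkQ _, hmem φ⟩)
    ⟨fun φ ψ h => ?_, fun ⟨ψ, hψ⟩ => ?_⟩).symm
  · exact Submodule.linearMap_qext _ (congrArg Subtype.val h)
  · refine ⟨Submodule.liftQ _ ψ ?_, Subtype.ext (Submodule.liftQ_mkQ _ _ _)⟩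
    rintro _ ⟨a, rfl⟩
    exact DFunLike.congr_fun (show ψ ∘ₗ f = 0 from hψ) a

/-- Exactness in the middle: a functional killing `ker f` descends to `A ⧸ ker f`, which embeds in
`B`, and injectivity of `ℚ_p / ℤ_p` extends it. -/
theorem range_dualHom (f : A →ₗ[ℤ_[p]] B) :
    (dualHom f).range = (dualHom (LinearMap.ker f).subtype).ker := by
  ext φ
  constructor
  · rintro ⟨ψ, rfl⟩
    refine LinearMap.ext fun a => ?_
    change ψ (f a) = 0
    rw [LinearMap.mem_ker.mp a.2, map_zero]
  · intro hφ
    have hle : LinearMap.ker f ≤ LinearMap.ker φ := fun a ha =>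
      DFunLike.congr_fun (show φ ∘ₗ (LinearMap.ker f).subtype = 0 from hφ)
        (⟨a, ha⟩ : LinearMap.ker f)
    obtain ⟨ψ, hψ⟩ := (QpModZp.baer p).extension_property
      (Submodule.liftQ _ f le_rfl) (LinearMap.ker_eq_bot.mp (Submodule.ker_liftQ_eq_bot _ _ _ le_rfl))
      (Submodule.liftQ _ φ hle)
    refine ⟨ψ, LinearMap.ext fun a => ?_⟩
    exact DFunLike.congr_fun hψ (Submodule.mkQ _ a)

theorem index_range_dualHom (f : A →ₗ[ℤ_[p]] B) :
    (dualHom f).range.index = Nat.card (LinearMap.ker f →ₗ[ℤ_[p]] QpModZp p) := by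
  rw [range_dualHom, AddSubgroup.index_ker,
    AddMonoidHom.range_eq_top.mpr (dualHom_surjective (Submodule.subtype_injective _))]
  exact AddSubgroup.card_top

theorem card_hom_eq_mul (N : Submodule ℤ_[p] A) :
    Nat.card (A →ₗ[ℤ_[p]] QpModZp p) = Nat.card (N →ₗ[ℤ_[p]] QpModZp p) *
      Nat.card ((A ⧸ N) →ₗ[ℤ_[p]] QpModZp p) := by
  have h := card_ker_dualHom N.subtype
  rw [Submodule.range_subtype] at h
  rw [← h, ← AddSubgroup.index_mul_card (dualHom N.subtype).ker, AddSubgroup.index_ker,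
    AddMonoidHom.range_eq_top.mpr (dualHom_surjective (Submodule.subtype_injective _)),
    AddSubgroup.card_top]

theorem exists_quotient_equiv_span {a : A} {n : ℕ} (ha : p ^ n • a = 0) :
    ∃ m : ℤ_[p], m ≠ 0 ∧ Nonempty ((ℤ_[p] ⧸ Ideal.span {m}) ≃ₗ[ℤ_[p]] Submodule.span ℤ_[p] {a}) := by
  obtain ⟨m, hm⟩ := (IsPrincipalIdealRing.principal
    (LinearMap.ker (LinearMap.toSpanSingleton ℤ_[p] A a))).principal
  have hp : (p ^ n : ℤ_[p]) ∈ LinearMap.ker (LinearMap.toSpanSingleton ℤ_[p] A a) := by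
    rw [LinearMap.mem_ker, LinearMap.toSpanSingleton_apply, ← ha, ← Nat.cast_smul_eq_nsmul ℤ_[p],
      Nat.cast_pow]
  refine ⟨m, ?_, ⟨?_⟩⟩
  · rintro rfl
    rw [hm, Submodule.span_zero_singleton, Submodule.mem_bot] at hp
    exact pow_ne_zero n (Nat.cast_ne_zero.mpr (Fact.out : p.Prime).ne_zero) hp
  · exact (Submodule.quotEquivOfEq _ _ hm.symm).trans
      ((LinearMap.quotKerEquivRange _).trans
        (LinearEquiv.ofEq _ _ (LinearMap.range_toSpanSingleton a)))

theorem card_hom_span {a : A} {n : ℕ} (ha : p ^ n • a = 0) :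
    Finite (Submodule.span ℤ_[p] {a}) ∧
      Nat.card (Submodule.span ℤ_[p] {a} →ₗ[ℤ_[p]] QpModZp p) =
        Nat.card (Submodule.span ℤ_[p] {a}) := by
  obtain ⟨m, hm, ⟨e⟩⟩ := exists_quotient_equiv_span ha
  have := Ring.HasFiniteQuotients.finiteQuotient (I := Ideal.span {m}) (by simpa using hm)
  refine ⟨Finite.of_equiv _ e.toEquiv, ?_⟩
  rw [← Nat.card_congr e.toEquiv, ← card_hom_quotient_span hm]
  exact Nat.card_congr (LinearEquiv.congrLeft (QpModZp p) ℤ_[p] e.symm).toEquiv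

/-- Induction on the order, splitting off a nonzero cyclic submodule; both sides are multiplicative
in short exact sequences. -/
theorem card_hom_of_finite [Finite A] (hA : ∀ a : A, ∃ n : ℕ, p ^ n • a = 0) :
    Nat.card (A →ₗ[ℤ_[p]] QpModZp p) = Nat.card A := by
  induction h : Nat.card A using Nat.strong_induction_on generalizing A with
  | _ k ih =>
    subst h
    rcases subsingleton_or_nontrivial A with hs | hn
    · rw [Nat.card_unique, Nat.card_unique]
    obtain ⟨a, ha⟩ := exists_ne (0 : A)
    obtain ⟨n, hna⟩ := hA a
    set N := Submodule.span ℤ_[p] {a}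
    have hcard : Nat.card A = Nat.card N * Nat.card (A ⧸ N) :=
      Submodule.card_eq_card_quotient_mul_card N
    have hN : Nontrivial N :=
      ⟨⟨a, Submodule.mem_span_singleton_self a⟩, 0, fun h => ha (congrArg Subtype.val h)⟩
    have : Finite (A ⧸ N) := Finite.of_surjective _ N.mkQ_surjective
    have hlt : Nat.card (A ⧸ N) < Nat.card A := by
      rw [hcard]
      exact lt_mul_of_one_lt_left Nat.card_pos Finite.one_lt_card
    rw [card_hom_eq_mul N, (card_hom_span hna).2, hcard]
    congr 1
    refine ih _ hlt (fun b => ?_) rfl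
    obtain ⟨b, rfl⟩ := Submodule.mkQ_surjective N b
    obtain ⟨j, hj⟩ := hA b
    exact ⟨j, by rw [← map_nsmul, hj, map_zero]⟩

theorem exists_hom_apply_ne_zero {a : A} {n : ℕ} (hn : p ^ n • a = 0) (ha : a ≠ 0) :
    ∃ φ : A →ₗ[ℤ_[p]] QpModZp p, φ a ≠ 0 := by
  set N := Submodule.span ℤ_[p] {a}
  obtain ⟨hfin, hcard⟩ := card_hom_span hn
  have hN : Nontrivial N :=
    ⟨⟨a, Submodule.mem_span_singleton_self a⟩, 0, fun h => ha (congrArg Subtype.val h)⟩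
  have h1 : 1 < Nat.card (N →ₗ[ℤ_[p]] QpModZp p) := hcard ▸ Finite.one_lt_card
  have := Nat.finite_of_card_ne_zero (by lia : Nat.card (N →ₗ[ℤ_[p]] QpModZp p) ≠ 0)
  have := Finite.one_lt_card_iff_nontrivial.mp h1
  obtain ⟨ψ, hψ⟩ := exists_ne (0 : N →ₗ[ℤ_[p]] QpModZp p)
  obtain ⟨φ, rfl⟩ := dualHom_surjective (Submodule.subtype_injective N) ψ
  refine ⟨φ, fun h => hψ (LinearMap.ext fun ⟨b, hb⟩ => ?_)⟩
  obtain ⟨z, rfl⟩ := Submodule.mem_span_singleton.mp hb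
  change φ (z • a) = 0
  rw [map_smul, h, smul_zero]

/-- If the dual has order `m`, all functionals take values in the finite `m`-torsion of `ℚ_p / ℤ_p`.
They separate points, so evaluation embeds `A` in a finite set. -/
theorem finite_of_finite_hom [Finite (A →ₗ[ℤ_[p]] QpModZp p)]
    (hA : ∀ a : A, ∃ n : ℕ, p ^ n • a = 0) : Finite A := by
  have hm : (Nat.card (A →ₗ[ℤ_[p]] QpModZp p) : ℤ_[p]) ≠ 0 := Nat.cast_ne_zero.mpr Nat.card_pos.ne'
  have := finite_range_divHom hm
  let ev : A → (A →ₗ[ℤ_[p]] QpModZp p) → LinearMap.range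
      (divHom p (Nat.card (A →ₗ[ℤ_[p]] QpModZp p) : ℤ_[p])) := fun a φ =>
    ⟨φ a, (mem_range_divHom hm _).mpr (by
      rw [Nat.cast_smul_eq_nsmul, ← LinearMap.smul_apply, card_nsmul_eq_zero',
        LinearMap.zero_apply])⟩
  refine Finite.of_injective ev fun a b hab => ?_
  by_contra hne
  obtain ⟨n, hn⟩ := hA (a - b)
  obtain ⟨φ, hφ⟩ := exists_hom_apply_ne_zero hn (sub_ne_zero.mpr hne)
  refine hφ ?_
  rw [map_sub, sub_eq_zero]
  exact congrArg Subtype.val (congrFun hab φ)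

/-- A `p`-primary `ℤ_p`-module has as many elements as its Pontryagin dual, where the cardinality
of infinite types is zero. -/
theorem card_hom_eq (hA : ∀ a : A, ∃ n : ℕ, p ^ n • a = 0) :
    Nat.card (A →ₗ[ℤ_[p]] QpModZp p) = Nat.card A := by
  rcases finite_or_infinite A with h | h
  · exact card_hom_of_finite hA
  · rcases finite_or_infinite (A →ₗ[ℤ_[p]] QpModZp p) with h' | h'
    · exact absurd (finite_of_finite_hom hA) (not_finite_iff_infinite.mpr h)
    · rw [Nat.card_eq_zero_of_infinite, Nat.card_eq_zero_of_infinite]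

theorem index_range_dualHom_eq_card_ker (hA : ∀ a : A, ∃ n : ℕ, p ^ n • a = 0)
    (f : A →ₗ[ℤ_[p]] B) : (dualHom f).range.index = Nat.card (LinearMap.ker f) := by
  rw [index_range_dualHom, card_hom_eq fun a => ?_]
  obtain ⟨n, hn⟩ := hA a
  exact ⟨n, Subtype.ext hn⟩

theorem card_ker_dualHom_eq_index_range (hB : ∀ b : B, ∃ n : ℕ, p ^ n • b = 0)
    (f : A →ₗ[ℤ_[p]] B) :
    Nat.card (dualHom f).ker = (LinearMap.range f).toAddSubgroup.index := by
  rw [card_ker_dualHom, card_hom_eq fun b => ?_]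
  · rfl
  obtain ⟨b, rfl⟩ := Submodule.mkQ_surjective _ b
  obtain ⟨n, hn⟩ := hB b
  exact ⟨n, by rw [← map_nsmul, hn, map_zero]⟩

end Duality

end Iwasawa

/-! ### Continuous cohomology of `Γ ≅ ℤ_p` -/

namespace Iwasawa

section Coordinate

variable {p : ℕ} [Fact p.Prime] {Γ : Type*} [Group Γ] [TopologicalSpace Γ]

theorem isOpen_pow_dvd_sub (n : ℕ) (a : ℤ_[p]) : IsOpen {x : ℤ_[p] | (p : ℤ_[p]) ^ n ∣ x - a} := by
  have : {x : ℤ_[p] | (p : ℤ_[p]) ^ n ∣ x - a} = Metric.closedBall a ((p : ℝ) ^ (-n : ℤ)) := by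
    ext x
    rw [Metric.mem_closedBall, dist_eq_norm, PadicInt.norm_le_pow_iff_mem_span_pow,
      Ideal.mem_span_singleton]
    rfl
  rw [this]
  exact IsUltrametricDist.isOpen_closedBall a
    (zpow_ne_zero _ (Nat.cast_ne_zero.mpr (Fact.out : p.Prime).ne_zero))

/-- A topological generator of a group isomorphic to `ℤ_p` gives a coordinate sending it to `1`. -/
theorem exists_coordinate (e : Γ ≃ₜ* Multiplicative ℤ_[p]) {γ : Γ}
    (hγ : Dense (Subgroup.zpowers γ : Set Γ)) :
    ∃ ε : Γ → ℤ_[p], Continuous ε ∧ (∀ g h, ε (g * h) = ε g + ε h) ∧ ε γ = 1 ∧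
      ∀ U : Set Γ, IsOpen U → 1 ∈ U → ∃ n : ℕ, ∀ g, (p : ℤ_[p]) ^ n ∣ ε g → g ∈ U := by
  have hcont : Continuous fun g => (e g).toAdd := continuous_toAdd.comp e.continuous
  -- Otherwise the closure of the powers of `γ` would lie in the proper closed subgroup
  -- corresponding to `pℤ_p`.
  have hu : IsUnit (e γ).toAdd := by
    by_contra hu
    rw [PadicInt.not_isUnit_iff, PadicInt.norm_lt_one_iff_dvd] at hu
    have hclosed : IsClosed {g | (p : ℤ_[p]) ∣ (e g).toAdd} := by
      have h1 : {x : ℤ_[p] | (p : ℤ_[p]) ∣ x} = Metric.ball 0 1 := by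
        ext x
        rw [mem_ball_zero_iff, PadicInt.norm_lt_one_iff_dvd]
        rfl
      have h2 : IsClosed {x : ℤ_[p] | (p : ℤ_[p]) ∣ x} := by
        rw [h1]
        exact IsUltrametricDist.isClosed_ball _ _
      exact h2.preimage hcont
    have hsub : (Subgroup.zpowers γ : Set Γ) ⊆ {g | (p : ℤ_[p]) ∣ (e g).toAdd} := by
      rintro _ ⟨k, rfl⟩
      change (p : ℤ_[p]) ∣ (e (γ ^ k)).toAdd
      rw [map_zpow, toAdd_zpow]
      rw [zsmul_eq_mul]
      exact hu.mul_left _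
    have hmem : e.symm (Multiplicative.ofAdd 1) ∈ {g | (p : ℤ_[p]) ∣ (e g).toAdd} :=
      hclosed.closure_subset_iff.mpr hsub (hγ _)
    rw [Set.mem_ofPred, ContinuousMulEquiv.apply_symm_apply, toAdd_ofAdd] at hmem
    exact PadicInt.prime_p.not_dvd_one hmem
  obtain ⟨u, hu⟩ := hu
  refine ⟨fun g => (u⁻¹ : ℤ_[p]ˣ) * (e g).toAdd, continuous_const.mul hcont, fun g h => ?_, ?_,
    fun U hU h1 => ?_⟩
  · simp only [map_mul, toAdd_mul, mul_add]
  · simp only [← hu, Units.inv_mul]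
  · have hV : IsOpen {x : ℤ_[p] | e.symm (Multiplicative.ofAdd x) ∈ U} :=
      hU.preimage (e.symm.continuous.comp continuous_ofAdd)
    have h0 : (0 : ℤ_[p]) ∈ {x : ℤ_[p] | e.symm (Multiplicative.ofAdd x) ∈ U} := by
      rw [Set.mem_ofPred, ofAdd_zero, map_one]
      exact h1
    obtain ⟨r, hr, hball⟩ := Metric.isOpen_iff.mp hV 0 h0
    obtain ⟨n, hn⟩ := PadicInt.exists_pow_neg_lt p hr
    refine ⟨n, fun g hg => ?_⟩
    have hmem : (e g).toAdd ∈ Metric.ball (0 : ℤ_[p]) r := by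
      rw [mem_ball_zero_iff]
      refine lt_of_le_of_lt ?_ hn
      rw [PadicInt.norm_le_pow_iff_mem_span_pow, Ideal.mem_span_singleton]
      exact (Units.dvd_mul_left (u := u⁻¹)).mp hg
    have := hball hmem
    rwa [Set.mem_ofPred, ofAdd_toAdd, ContinuousMulEquiv.symm_apply_apply] at this

end Coordinate

section Cocycle

variable {p : ℕ} [Fact p.Prime] {Γ : Type*} [Group Γ] [TopologicalSpace Γ]
  {D : Type*} [AddCommGroup D] [TopologicalSpace D] [DiscreteTopology D] [DistribMulAction Γ D]

theorem smul_eq_of_dense [ContinuousSMul Γ D] {γ : Γ}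
    (hγ : Dense (Subgroup.zpowers γ : Set Γ)) {d : D} (hd : γ • d = d) (g : Γ) : g • d = d := by
  have hclosed : IsClosed {g : Γ | g • d = d} :=
    isClosed_eq (continuous_id.smul continuous_const) continuous_const
  refine hclosed.closure_subset_iff.mpr ?_ (hγ g)
  have : Subgroup.zpowers γ ≤ MulAction.stabilizer Γ d := by
    rwa [Subgroup.zpowers_le, MulAction.mem_stabilizer_iff]
  exact this

/-- A continuous cocycle vanishing at a topological generator is zero. -/
theorem cocycle_eq_zero_of_dense {γ : Γ} (hγ : Dense (Subgroup.zpowers γ : Set Γ)) {c : Γ → D}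
    (hc : c ∈ Z1 Γ D) (h0 : c γ = 0) (g : Γ) : c g = 0 := by
  obtain ⟨hcont, hmul⟩ := hc
  let H : Subgroup Γ :=
    { carrier := {g | c g = 0}
      one_mem' := by simpa using hmul 1 1
      mul_mem' := fun {a b} (ha : c a = 0) (hb : c b = 0) => show c (a * b) = 0 by
        rw [hmul, ha, hb, smul_zero, add_zero]
      inv_mem' := fun {a} (ha : c a = 0) => show c a⁻¹ = 0 by
        have h1 : c 1 = 0 := by simpa using hmul 1 1
        have h2 := hmul a⁻¹ a
        rwa [inv_mul_cancel, h1, ha, smul_zero, add_zero, eq_comm] at h2 }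
  have hclosed : IsClosed {g | c g = 0} := isClosed_eq hcont continuous_const
  refine hclosed.closure_subset_iff.mpr ?_ (hγ g)
  have : Subgroup.zpowers γ ≤ H := Subgroup.zpowers_le.mpr h0
  exact this

/-- Any value at a topological generator of `Γ ≅ ℤ_p` extends to a continuous cocycle with
coefficients in a discrete `p`-primary module. -/
theorem exists_cocycle [ContinuousSMul Γ D] (e : Γ ≃ₜ* Multiplicative ℤ_[p]) {γ : Γ}
    (hγ : Dense (Subgroup.zpowers γ : Set Γ)) {d : D} {m : ℕ} (hd : p ^ m • d = 0) :
    ∃ c ∈ Z1 Γ D, c γ = d := by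
  obtain ⟨ε, hε, hmul, hε1, hnhds⟩ := exists_coordinate e hγ
  -- The stabilizer of `d` is open, so it contains all `g` with `p ^ n ∣ ε g`.
  obtain ⟨n, hn⟩ := hnhds {g | g • d = d}
    ((isOpen_discrete {d}).preimage (continuous_id.smul continuous_const)) (one_smul Γ d)
  have hcomm (g h : Γ) : g * h = h * g := e.injective (by rw [map_mul, map_mul, mul_comm])
  have hpow (k : ℕ) : ε (γ ^ k) = k := by
    have h1 : ε 1 = 0 := by simpa using hmul 1 1
    induction k with
    | zero => simpa using h1
    | succ k ih => rw [pow_succ, hmul, ih, hε1, Nat.cast_succ]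
  -- The cocycle rule forces `c (γ ^ k) = s k`. It remains to show that `s` is periodic modulo a
  -- power of `p`, so that it extends continuously along `ε`.
  let s : ℕ → D := fun k => ∑ i ∈ Finset.range k, γ ^ i • d
  have hs_add (k l : ℕ) : s (k + l) = s k + γ ^ k • s l := by
    simp only [s, Finset.sum_range_add, Finset.smul_sum, pow_add, mul_smul]
  have hfix (g : Γ) (hg : (p : ℤ_[p]) ^ n ∣ ε g) (k : ℕ) : g • s k = s k := by
    simp only [s, Finset.smul_sum]
    refine Finset.sum_congr rfl fun i _ => ?_
    rw [← mul_smul, hcomm, mul_smul, show g • d = d from hn g hg]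
  have hs_mul (r : ℕ) : s (p ^ n * r) = r • s (p ^ n) := by
    induction r with
    | zero => simp [s]
    | succ r ih =>
      rw [Nat.mul_succ, hs_add, ih, hfix _ ?_, succ_nsmul]
      rw [hpow]
      push_cast
      exact dvd_mul_right _ _
  -- The exponent `n` makes `γ ^ (p ^ n)` act trivially on the terms, so that blocks of length `p ^
  -- n` repeat; the exponent `m` then kills `p ^ m` equal blocks.
  have hs_zero (r : ℕ) : s (p ^ (n + m) * r) = 0 := by
    rw [pow_add, mul_assoc, hs_mul, mul_comm, mul_nsmul]
    have : p ^ m • s (p ^ n) = 0 := by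
      simp only [s, Finset.smul_sum]
      refine Finset.sum_eq_zero fun i _ => ?_
      rw [smul_comm, hd, smul_zero]
    rw [← mul_nsmul, mul_nsmul', this, smul_zero]
  have hs_congr {k l : ℕ} (h : (k : ZMod (p ^ (n + m))) = l) : s k = s l := by
    wlog hkl : k ≤ l generalizing k l
    · exact (this h.symm (le_of_not_ge hkl)).symm
    rw [ZMod.natCast_eq_natCast_iff, Nat.modEq_iff_dvd' hkl] at h
    obtain ⟨r, hr⟩ := h
    rw [← Nat.add_sub_cancel' hkl, hs_add, hr, hs_zero, smul_zero, add_zero]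
  have : NeZero (p ^ (n + m)) := ⟨pow_ne_zero _ (Fact.out : p.Prime).ne_zero⟩
  have hdvd (x y : ℤ_[p]) : (p : ℤ_[p]) ^ (n + m) ∣ x - y ↔
      PadicInt.toZModPow (n + m) x = PadicInt.toZModPow (n + m) y := by
    rw [← Ideal.mem_span_singleton, ← PadicInt.ker_toZModPow, RingHom.mem_ker, map_sub, sub_eq_zero]
  let v : Γ → ℕ := fun g => (PadicInt.toZModPow (n + m) (ε g)).val
  have hv (g : Γ) : (v g : ZMod (p ^ (n + m))) = PadicInt.toZModPow (n + m) (ε g) :=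
    ZMod.natCast_zmod_val _
  -- `g` and `γ ^ v g` differ by an element whose coordinate is divisible by `p ^ n`, hence one
  -- fixing `s k`.
  have hsmul (g : Γ) (k : ℕ) : g • s k = γ ^ v g • s k := by
    have hg : g = γ ^ v g * ((γ ^ v g)⁻¹ * g) := (mul_inv_cancel_left _ _).symm
    have hε' : ε ((γ ^ v g)⁻¹ * g) = ε g - v g := by
      have := hmul (γ ^ v g) ((γ ^ v g)⁻¹ * g)
      rw [← hg, hpow] at this
      rw [this, add_sub_cancel_left]
    conv_lhs => rw [hg, mul_smul]
    rw [hfix]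
    rw [hε']
    refine (pow_dvd_pow _ (Nat.le_add_right n m)).trans ((hdvd _ _).mpr ?_)
    rw [map_natCast, hv]
  refine ⟨fun g => s (v g), ⟨?_, fun g h => ?_⟩, ?_⟩
  · refine IsLocallyConstant.continuous ((IsLocallyConstant.iff_exists_open _).mpr fun g =>
      ⟨_, (isOpen_pow_dvd_sub (n + m) (ε g)).preimage hε, ?_, fun h hh => ?_⟩)
    · change (p : ℤ_[p]) ^ (n + m) ∣ ε g - ε g
      rw [sub_self]
      exact dvd_zero _
    · refine hs_congr ?_
      rw [hv, hv]
      exact (hdvd _ _).mp hh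
  · change s (v (g * h)) = s (v g) + g • s (v h)
    rw [hsmul, ← hs_add]
    refine hs_congr ?_
    rw [Nat.cast_add, hv, hv, hv, hmul, map_add]
  · have h1 : s (v γ) = s 1 := hs_congr (by rw [hv, hε1, map_one, Nat.cast_one])
    rw [show (fun g => s (v g)) γ = s (v γ) from rfl, h1]
    simp [s]

/-- For `Γ ≅ ℤ_p` topologically generated by `γ`, the group `H¹(Γ, D)` is `D / (γ - 1) D`. -/
theorem card_H1 [ContinuousSMul Γ D] (e : Γ ≃ₜ* Multiplicative ℤ_[p]) {γ : Γ}
    (hγ : Dense (Subgroup.zpowers γ : Set Γ)) (hprim : ∀ d : D, ∃ n : ℕ, p ^ n • d = 0)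
    {T : D →+ D} (hT : ∀ d, T d = γ • d - d) : Nat.card (H1 Γ D) = T.range.index := by
  let ev : Z1 Γ D →+ D := (Pi.evalAddMonoidHom (fun _ : Γ => D) γ).comp (Z1 Γ D).subtype
  have hev : Function.Surjective ev := fun d => by
    obtain ⟨n, hn⟩ := hprim d
    obtain ⟨c, hc, hd⟩ := exists_cocycle e hγ hn
    exact ⟨⟨c, hc⟩, hd⟩
  rw [← AddSubgroup.index_comap_of_surjective _ hev]
  change ((B1 Γ D).addSubgroupOf (Z1 Γ D)).index = _
  congr 1
  ext ⟨c, hc⟩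
  constructor
  · rintro ⟨d, hd⟩
    exact ⟨d, (hT d).trans (hd γ).symm⟩
  · rintro ⟨d, hd⟩
    refine ⟨d, fun g => ?_⟩
    -- Subtracting the coboundary of `d` leaves a continuous cocycle that vanishes at `γ`, hence
    -- everywhere.
    have hcb : (fun g => c g - (g • d - d)) ∈ Z1 Γ D := by
      refine ⟨hc.1.sub ((continuous_id.smul continuous_const).sub continuous_const),
        fun g h => ?_⟩
      simp only [hc.2 g h, mul_smul, smul_sub]
      abel
    refine sub_eq_zero.mp (cocycle_eq_zero_of_dense hγ hcb ?_ g)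
    exact sub_eq_zero.mpr (hd.symm.trans (hT d))

end Cocycle

/-- In a discrete valuation ring with finite residue field, `|x|⁻¹` is the index of the ideal
generated by `x`. -/
theorem inv_absVal_eq_card {O : Type*} [CommRing O] [IsDomain O] [IsDiscreteValuationRing O]
    [Infinite O] {ϖ : O} (hϖ : Irreducible ϖ) {x : O} (hx : x ≠ 0) :
    (absVal ϖ x)⁻¹ = Nat.card (O ⧸ Ideal.span {x}) := by
  have hassoc : Associated x (ϖ ^ multiplicity ϖ x) := by
    obtain ⟨n, hn⟩ := IsDiscreteValuationRing.associated_pow_irreducible hx hϖ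
    rwa [multiplicity_eq_of_associated_right hn, multiplicity_pow_self_of_prime hϖ.prime]
  rw [absVal, if_neg hx, inv_pow, inv_inv, Ideal.span_singleton_eq_span_singleton.mpr hassoc,
    card_quotient_span_pow, Nat.cast_pow]

end Iwasawa

/-! ### The Euler characteristic formula -/

theorem proposition3p3
    (p : ℕ) [Fact p.Prime]
    -- `O` is the valuation ring of a finite extension of `ℚ_p`, with uniformizer `ϖ`
    (O : Type*) [CommRing O] [IsDomain O] [IsDiscreteValuationRing O]
    [Algebra ℤ_[p] O] [Module.Finite ℤ_[p] O]
    (ϖ : O) (hϖ : Irreducible ϖ)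
    -- `Γ` is a topological group isomorphic to `ℤ_p`, with topological generator `γ`
    (Γ : Type*) [Group Γ] [TopologicalSpace Γ]
    (hΓ : Nonempty (Γ ≃ₜ* Multiplicative ℤ_[p]))
    (γ : Γ) (hγ : Dense (Subgroup.zpowers γ : Set Γ))
    -- `D` is a discrete `p`-primary `Λ_O`-module, on which `γ` acts as `1 + T`
    (D : Type*) [AddCommGroup D] [Module ℤ_[p] D] [Module (Iwasawa.IwasawaAlgebra O) D]
    [IsScalarTower ℤ_[p] (Iwasawa.IwasawaAlgebra O) D]
    [TopologicalSpace D] [DiscreteTopology D] [DistribMulAction Γ D] [ContinuousSMul Γ D]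
    (hγD : ∀ d : D, γ • d = (1 + PowerSeries.X : Iwasawa.IwasawaAlgebra O) • d)
    (hprim : ∀ d : D, ∃ n : ℕ, p ^ n • d = 0)
    -- `D` is cofinitely generated and cotorsion
    (hfg : Module.Finite (Iwasawa.IwasawaAlgebra O) (Iwasawa.Dual p D))
    (htors : Module.IsTorsion (Iwasawa.IwasawaAlgebra O) (Iwasawa.Dual p D))
    -- `f` is the characteristic series of `D`, that is, of its Pontryagin dual
    (f : Iwasawa.IwasawaAlgebra O)
    (hf : Iwasawa.IsCharacteristicElement ϖ (Iwasawa.Dual p D) f) :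
    (PowerSeries.constantCoeff f ≠ 0 ↔ Iwasawa.EulerCharWellDefined Γ D) ∧
    (PowerSeries.constantCoeff f ≠ 0 →
      Iwasawa.eulerChar Γ D = (Iwasawa.absVal ϖ (PowerSeries.constantCoeff f))⁻¹) := by
  open Iwasawa PowerSeries in
  obtain ⟨e⟩ := hΓ
  have hinf : Infinite O := not_finite_iff_infinite.mp fun _ =>
    IsDiscreteValuationRing.not_isField O (Finite.isField_of_domain O)
  have hquot : Ring.HasFiniteQuotients O := Ring.HasFiniteQuotients.of_module_finite ℤ_[p] O
  let T : D →ₗ[ℤ_[p]] D := Algebra.lsmul ℤ_[p] ℤ_[p] D (X : IwasawaAlgebra O)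
  have hT (d : D) : T d = γ • d - d := by
    rw [hγD, add_smul, one_smul, add_sub_cancel_left]
    rfl
  -- `X` acts on the dual by precomposition with `T`, so `smulHom` here is `dualHom T` by
  -- definition. Density of the powers of `γ` reduces invariance under `Γ` to invariance under `γ`.
  have hH0 : Nat.card (H0 Γ D) =
      (smulHom (X : IwasawaAlgebra O) (Dual p D)).range.index := by
    refine Eq.trans ?_ (index_range_dualHom_eq_card_ker hprim T).symm
    refine Nat.card_congr (Equiv.subtypeEquivRight fun d => ?_)
    change (∀ g : Γ, g • d = d) ↔ T d = 0
    rw [hT, sub_eq_zero]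
    exact ⟨fun h => h γ, fun h => smul_eq_of_dense hγ h⟩
  have hH1 : Nat.card (H1 Γ D) = Nat.card (smulHom (X : IwasawaAlgebra O) (Dual p D)).ker := by
    refine (card_H1 e hγ hprim (T := T.toAddMonoidHom) hT).trans ?_
    exact (card_ker_dualHom_eq_index_range hprim T).symm
  obtain ⟨h0, h1⟩ := hf.index_range
  have hpos (hne : constantCoeff f ≠ 0) : Nat.card (O ⧸ Ideal.span {constantCoeff f}) ≠ 0 := by
    have := Ring.HasFiniteQuotients.finiteQuotient (I := Ideal.span {constantCoeff f})
      (by simpa using hne)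
    exact Nat.card_pos.ne'
  have hfin (hne : constantCoeff f ≠ 0) : Nat.card (H1 Γ D) ≠ 0 := by
    have := (h1 hne).1
    rw [hH1]
    exact Nat.card_pos.ne'
  refine ⟨⟨fun hne => Nat.finite_of_card_ne_zero ?_, fun hwd hz => ?_⟩, fun hne => ?_⟩
  · rw [hH0, (h1 hne).2, ← hH1]
    exact mul_ne_zero (hpos hne) (hfin hne)
  -- A finite `H⁰` contains `0`, so its cardinality is positive, whereas `f(0) = 0` makes the count
  -- zero.
  · have : Finite (H0 Γ D) := hwd
    exact Nat.card_pos.ne' (hH0.trans (h0 hz))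
  · rw [inv_absVal_eq_card hϖ hne, eulerChar, hH0, (h1 hne).2, ← hH1, Nat.cast_mul]
    exact mul_div_cancel_right₀ _ (Nat.cast_ne_zero.mpr (hfin hne))
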